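/- A family $\{u_i\}_{i\in I}$ in a real or complex Hilbert space $\mathcal H$ is a *frame with bounds* $A,B$, where $0<A\le B<\infty$, if $A\|u\|^2\le\sum_{i\in I}|\langle u,u_i\rangle|^2\le B\|u\|^2$ for all $u\in\mathcal H$; it is a *Parseval frame* if this holds with $A=B=1$. **Theorem ($KS_2^\infty$).** There is a universal constant $C>0$ with the following property. Let $I$ be an at most countable index set, let $\mathcal H$ be a separable (real or complex) Hilbert space, let $\delta\ge 0$, and let $\{u_i\}_{i\in I}\subset\mathcal H$ be a Parseval frame with $\|u_i\|^2\le\delta$ for all $i\in I$. Then there exists a partition of $I$ into two (possibly empty) sets $I_1,I_2$ such that, both for $\varepsilon=C\sqrt\delta$ and for $\varepsilon=\sqrt{2\delta}+\delta$, $$\Big(\frac12-\varepsilon\Big)\|u\|^2\;\le\;\sum_{i\in I_k}|\langle u,u_i\rangle|^2\;\le\;\Big(\frac12+\varepsilon\Big)\|u\|^2\qquad\text{for all }u\in\mathcal H,\ k=1,2.$$ In particular, whenever $\varepsilon<\frac12$ for one of these two values, each of $\{u_i\}_{i\in I_1}$ and $\{u_i\}_{i\in I_2}$ is a frame for $\mathcal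 H$ with bounds $\frac12-\varepsilon$ and $\frac12+\varepsilon$. -/

import Mathlib

/-- The frame inequality `A ‖x‖² ≤ ∑ i, |⟨x, u i⟩|² ≤ B ‖x‖²` for all `x`, the series being
convergent. No sign condition is imposed on `A` and `B`. -/
def FrameInequality (𝕜 : Type*) [RCLike 𝕜] {H : Type*} [NormedAddCommGroup H]
    [InnerProductSpace 𝕜 H] {ι : Type*} (u : ι → H) (A B : ℝ) : Prop :=
  ∀ x : H, Summable (fun i => ‖inner 𝕜 x (u i)‖ ^ 2) ∧
    A * ‖x‖ ^ 2 ≤ ∑' i, ‖inner 𝕜 x (u i)‖ ^ 2 ∧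
    ∑' i, ‖inner 𝕜 x (u i)‖ ^ 2 ≤ B * ‖x‖ ^ 2

/-- The family `u` is a frame with lower bound `A` and upper bound `B`, where `0 < A ≤ B < ∞`. -/
def IsFrameWithBounds (𝕜 : Type*) [RCLike 𝕜] {H : Type*} [NormedAddCommGroup H]
    [InnerProductSpace 𝕜 H] {ι : Type*} (u : ι → H) (A B : ℝ) : Prop :=
  0 < A ∧ A ≤ B ∧ FrameInequality 𝕜 u A B

/-- A Parseval frame is a frame with both bounds equal to `1`. -/
def IsParsevalFrame (𝕜 : Type*) [RCLike 𝕜] {H : Type*} [NormedAddCommGroup H]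
    [InnerProductSpace 𝕜 H] {ι : Type*} (u : ι → H) : Prop :=
  IsFrameWithBounds 𝕜 u 1 1

/-! The lower bound for one class is the upper bound for the other, since the two sums add up to
‖u‖². So only upper bounds are needed, and by compactness (`Finset.rado_selection`) it is enough to
treat finite Bessel families.

Let G = Bᴴ B be the Gram matrix of a finite, rescaled family and Q(z) = det(1 + diag(z) G). Q is
multiaffine and real stable, and so is F(z, z') = Q(z) Q(z'), which has one pair of coordinates per
vector. For multiaffine F, (1 - 2∂ₛ)F is the shift F(z - 2eₛ), so 1 - ∂ₛ - ∂ₜ averages two shifts.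
Taking s, t to be the pair of index i, the two shifts put i in one class or the other.

Two facts about the Rayleigh inequality f ∂ᵢ∂ⱼf ≤ ∂ᵢf ∂ⱼf, which real stability provides, carry the
proof. A barrier argument in the style of Marcus, Spielman and Srivastava
(`IsRealStable.barrier_pairOpList`) shows that the average over all choices is positive on the
orthant above (a, ..., a). And whenever an average of two shifts is positive on an orthant, one of
the shifts is (`IsRayleigh.exists_posAbove_sub_single`); this replaces interlacing families, and
iterating it selects one partition (`IsRealStable.exists_selection`).

For that partition det(1 + B diag(a + r - 2·1[i in class k]) Bᴴ) ≠ 0 for all r ≥ 0, so the matrix at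
r = 0 is positive semidefinite. As a quadratic form this says that twice the class sum is at most
‖y‖² + a Σ|⟨y, uᵢ⟩|². -/

/-- The forward difference of `F` in the coordinate `i`; it is the partial derivative of `F` if `F`
is affine in that coordinate. -/
def partialDiff {σ R : Type*} [DecidableEq σ] [CommRing R] (i : σ) (F : (σ → R) → R) (z : σ → R) :
    R :=
  F (z + Pi.single i 1) - F z

/-- `F` is affine in every coordinate. -/
def IsMultiaffine {σ R : Type*} [DecidableEq σ] [CommRing R] (F : (σ → R) → R) : Prop :=
  ∀ i z w, F (z + Pi.single i w) = F z + w * partialDiff i F z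

/-- A multiaffine real function with the Rayleigh property. -/
structure IsRayleigh {σ : Type*} [DecidableEq σ] (f : (σ → ℝ) → ℝ) : Prop where
  affine : IsMultiaffine f
  rayleigh : ∀ i j x, i ≠ j →
    f x * partialDiff i (partialDiff j f) x ≤ partialDiff i f x * partialDiff j f x

/-- The function `f` is positive on the orthant with vertex `b`. -/
def PosAbove {σ : Type*} (f : (σ → ℝ) → ℝ) (b : σ → ℝ) : Prop :=
  ∀ y, b ≤ y → 0 < f y

theorem PosAbove.mono {σ : Type*} {f : (σ → ℝ) → ℝ} {b c : σ → ℝ} (h : PosAbove f b)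
    (hbc : b ≤ c) : PosAbove f c :=
  fun y hy => h y (hbc.trans hy)

/-! ### Calculus of multiaffine functions -/

section Multiaffine

variable {σ R : Type*} [DecidableEq σ] [CommRing R] {F G : (σ → R) → R}

theorem partialDiff_comm (i j : σ) (F : (σ → R) → R) :
    partialDiff i (partialDiff j F) = partialDiff j (partialDiff i F) := by
  funext z
  simp only [partialDiff, add_right_comm z (Pi.single i 1)]
  ring

theorem IsMultiaffine.partialDiff_add_single_self (hF : IsMultiaffine F) (i : σ) (z : σ → R)
    (w : R) : partialDiff i F (z + Pi.single i w) = partialDiff i F z := by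
  have h := hF i z (w + 1)
  rw [Pi.single_add, ← add_assoc] at h
  rw [partialDiff, h, hF i z w]
  ring

theorem IsMultiaffine.diff (hF : IsMultiaffine F) (j : σ) :
    IsMultiaffine (partialDiff j F) := by
  intro i z w
  simp only [partialDiff]
  rw [add_right_comm z (Pi.single i w), hF i, hF i z, add_right_comm z (Pi.single i 1)]
  simp only [partialDiff]
  ring

theorem IsMultiaffine.sub (hF : IsMultiaffine F) (hG : IsMultiaffine G) :
    IsMultiaffine (fun z => F z - G z) := by
  intro i z w
  simp only [partialDiff]
  rw [hF i z w, hG i z w]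
  simp only [partialDiff]
  ring

theorem IsMultiaffine.comp_sub (hF : IsMultiaffine F) (v : σ → R) :
    IsMultiaffine (fun z => F (z - v)) := by
  intro i z w
  simp only [partialDiff, add_sub_right_comm]
  rw [hF]
  simp only [partialDiff]

theorem IsMultiaffine.apply_sub_single (hF : IsMultiaffine F) (i : σ) (z : σ → R) (w : R) :
    F (z - Pi.single i w) = F z - w * partialDiff i F z := by
  rw [sub_eq_add_neg, ← Pi.single_neg, hF]
  ring

end Multiaffine

/-- A function that does not increase along the coordinate directions is antitone. -/
theorem le_of_forall_add_single_le {σ : Type*} [DecidableEq σ] [Fintype σ] {g : (σ → ℝ) → ℝ}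
    {b : σ → ℝ} (h : ∀ y, b ≤ y → ∀ j r, 0 ≤ r → g (y + Pi.single j r) ≤ g y) {y z : σ → ℝ}
    (hb : b ≤ y) (hyz : y ≤ z) : g z ≤ g y := by
  have key : ∀ S : Finset σ, g (y + ∑ j ∈ S, Pi.single j ((z - y) j)) ≤ g y := by
    intro S
    induction S using Finset.induction_on with
    | empty => simp
    | insert j S hj ih =>
      rw [Finset.sum_insert hj, add_comm (Pi.single j _), ← add_assoc]
      refine (h _ ?_ j _ (sub_nonneg.2 (hyz j))).trans ih
      refine hb.trans (le_add_of_nonneg_right (Finset.sum_nonneg fun k _ => ?_))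
      exact Pi.single_nonneg.2 (sub_nonneg.2 (hyz k))
  have := key Finset.univ
  rwa [Finset.univ_sum_single, add_sub_cancel] at this

/-! ### Monotonicity of the barrier function ∂ᵢf / f -/

section Rayleigh

variable {σ : Type*} [DecidableEq σ] {f : (σ → ℝ) → ℝ} {b : σ → ℝ}

theorem le_add_single {b y : σ → ℝ} (hy : b ≤ y) (i : σ) {r : ℝ} (hr : 0 ≤ r) :
    b ≤ y + Pi.single i r :=
  hy.trans (le_add_of_nonneg_right (Pi.single_nonneg.2 hr))

theorem nonneg_of_forall_affine_nonneg {p q : ℝ} (h : ∀ r : ℝ, 0 ≤ r → 0 ≤ p + r * q) : 0 ≤ q := by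
  by_contra! hq
  have h1 := h ((|p| + 1) / -q) (div_nonneg (by positivity) (by linarith))
  rw [div_mul_eq_mul_div, div_neg, mul_div_assoc, div_self hq.ne] at h1
  linarith [le_abs_self p]

theorem IsMultiaffine.partialDiff_nonneg (hf : IsMultiaffine f)
    (h : ∀ y, b ≤ y → 0 ≤ f y) (i : σ) {y : σ → ℝ} (hy : b ≤ y) : 0 ≤ partialDiff i f y := by
  refine nonneg_of_forall_affine_nonneg (p := f y) fun r hr => ?_
  rw [← hf i y r]
  exact h _ (le_add_single hy i hr)

/-- Along eⱼ the derivative of ∂ᵢf / f has the sign of f ∂ⱼ∂ᵢf - ∂ᵢf ∂ⱼf. For j ≠ i this is the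
Rayleigh inequality; for j = i the second derivative vanishes and -(∂ᵢf)² remains. -/
theorem IsRayleigh.barrier_antitone [Fintype σ] (hf : IsRayleigh f) (hb : PosAbove f b) (i : σ)
    {y z : σ → ℝ} (hy : b ≤ y) (hyz : y ≤ z) :
    partialDiff i f z / f z ≤ partialDiff i f y / f y := by
  refine le_of_forall_add_single_le (g := fun x => partialDiff i f x / f x) ?_ hy hyz
  intro x hx j r hr
  have h0 := hb x hx
  have h1 := hb _ (le_add_single hx j hr)
  rw [div_le_div_iff₀ h1 h0]
  rw [hf.affine j x r] at *
  rcases eq_or_ne j i with rfl | hji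
  · rw [hf.affine.partialDiff_add_single_self]
    nlinarith [mul_nonneg hr (sq_nonneg (partialDiff j f x))]
  · rw [hf.affine.diff i j x r]
    nlinarith [mul_le_mul_of_nonneg_left (hf.rayleigh j i x hji) hr]

end Rayleigh

/-! ### The barrier step for one pair of coordinates -/

/-- For quadratics P and N with N/P nonincreasing, the value of (N - N')/(P - P') at 0 is at most
N/P at -a. The Wronskian N P' - N' P = α + 2βτ + γτ² is nonnegative on the whole line, so β² ≤ αγ.
This puts N/P at -a above its tangent at 0, that is above N0/P0 + aα/P0², and `hbar` puts (N0 -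
N1)/(P0 - P1) below the same number. -/
theorem quadratic_barrier {P0 P1 P2 N0 N1 N2 a : ℝ} (ha : 0 < a)
    (hW : ∀ τ : ℝ, (N1 + 2 * N2 * τ) * (P0 + P1 * τ + P2 * τ ^ 2) ≤
      (N0 + N1 * τ + N2 * τ ^ 2) * (P1 + 2 * P2 * τ))
    (hP : ∀ τ, -a ≤ τ → 0 < P0 + P1 * τ + P2 * τ ^ 2) (hP2 : 0 ≤ P2)
    (hP1 : 0 ≤ P1 - 2 * P2 * a) (hbar : P0 ≤ a * (P0 - P1)) :
    (N0 - N1) * (P0 - P1 * a + P2 * a ^ 2) ≤ (N0 - N1 * a + N2 * a ^ 2) * (P0 - P1) := by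
  have h0 : 0 < P0 := by simpa using hP 0 (by linarith)
  have hPa : 0 < P0 - P1 * a + P2 * a ^ 2 := by
    have := hP (-a) le_rfl
    linarith [this, show P0 + P1 * -a + P2 * (-a) ^ 2 = P0 - P1 * a + P2 * a ^ 2 by ring]
  obtain ⟨α, hα⟩ : ∃ α, α = N0 * P1 - N1 * P0 := ⟨_, rfl⟩
  obtain ⟨β, hβ⟩ : ∃ β, β = N0 * P2 - N2 * P0 := ⟨_, rfl⟩
  obtain ⟨γ, hγ⟩ : ∃ γ, γ = N1 * P2 - N2 * P1 := ⟨_, rfl⟩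
  have hW' : ∀ τ : ℝ, 0 ≤ γ * (τ * τ) + 2 * β * τ + α := by
    intro τ
    have := hW τ
    rw [hα, hβ, hγ]
    linarith
  have hα0 : 0 ≤ α := by simpa using hW' 0
  have hd : β ^ 2 ≤ α * γ := by
    have := discrim_le_zero hW'
    rw [discrim] at this
    linarith
  have hid : β * P1 = α * P2 + γ * P0 := by rw [hα, hβ, hγ]; ring
  have hP1' : a * P2 ≤ P1 := by nlinarith
  have htan : β * P0 ≤ α * (P1 - a * P2) := by
    rcases le_or_gt β 0 with hβ0 | hβ0
    · exact (mul_nonpos_of_nonpos_of_nonneg hβ0 h0.le).trans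
        (mul_nonneg hα0 (sub_nonneg.2 hP1'))
    · have hαpos : 0 < α := by
        rcases hα0.eq_or_lt with h | h
        · rw [← h] at hd
          nlinarith [pow_pos hβ0 2]
        · exact h
      have h1 : β ^ 2 * P0 + α ^ 2 * P2 ≤ α * β * P1 := by
        have : α * β * P1 = α ^ 2 * P2 + α * γ * P0 := by rw [mul_assoc, hid]; ring
        nlinarith [mul_le_mul_of_nonneg_right hd h0.le]
      -- By `h1`, P is nonpositive at -α/β, so this point must lie to the left of -a.
      have h2 : a * β < α := by
        by_contra! hc
        have h3 : -a ≤ -(α / β) := by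
          rw [neg_le_neg_iff, div_le_iff₀ hβ0]
          exact hc
        have h4 := mul_pos (hP _ h3) (pow_pos hβ0 2)
        have h5 : (P0 + P1 * -(α / β) + P2 * (-(α / β)) ^ 2) * β ^ 2 =
            P0 * β ^ 2 - P1 * α * β + P2 * α ^ 2 := by
          field_simp
          ring
        rw [h5] at h4
        linarith
      have h6 : β * (β * P0) ≤ β * (α * (P1 - a * P2)) := by
        nlinarith [mul_nonneg (mul_nonneg hαpos.le hP2) (sub_nonneg.2 h2.le)]
      exact le_of_mul_le_mul_left h6 hβ0
  -- The tangent inequality at -a with denominators cleared; the defect is a² times that of `htan`.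
  have htan' : (N0 * P0 + a * α) * (P0 - P1 * a + P2 * a ^ 2) ≤
      (N0 - N1 * a + N2 * a ^ 2) * P0 ^ 2 := by
    have h7 : (N0 - N1 * a + N2 * a ^ 2) * P0 ^ 2 -
        (N0 * P0 + a * α) * (P0 - P1 * a + P2 * a ^ 2) =
        a ^ 2 * (α * (P1 - a * P2) - β * P0) := by rw [hα, hβ]; ring
    have h8 := mul_nonneg (sq_nonneg a) (sub_nonneg.2 htan)
    linarith
  have hs : 0 ≤ P0 - P1 := by
    by_contra! h
    nlinarith
  have h9 : (N0 - N1) * P0 ^ 2 ≤ (N0 * P0 + a * α) * (P0 - P1) := by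
    have h10 := mul_le_mul_of_nonneg_left hbar hα0
    have h11 : (N0 * P0 + a * α) * (P0 - P1) - (N0 - N1) * P0 ^ 2 =
        α * (a * (P0 - P1)) - α * P0 := by rw [hα]; ring
    linarith
  refine le_of_mul_le_mul_right ?_ (pow_pos h0 2)
  calc (N0 - N1) * (P0 - P1 * a + P2 * a ^ 2) * P0 ^ 2
      = (N0 - N1) * P0 ^ 2 * (P0 - P1 * a + P2 * a ^ 2) := by ring
    _ ≤ (N0 * P0 + a * α) * (P0 - P1) * (P0 - P1 * a + P2 * a ^ 2) :=
        mul_le_mul_of_nonneg_right h9 hPa.le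
    _ = (N0 * P0 + a * α) * (P0 - P1 * a + P2 * a ^ 2) * (P0 - P1) := by ring
    _ ≤ (N0 - N1 * a + N2 * a ^ 2) * P0 ^ 2 * (P0 - P1) :=
        mul_le_mul_of_nonneg_right htan' hs
    _ = (N0 - N1 * a + N2 * a ^ 2) * (P0 - P1) * P0 ^ 2 := by ring

/-- The operator `1 - ∂ₛ - ∂ₜ` on multiaffine functions. -/
def pairOp {σ R : Type*} [DecidableEq σ] [CommRing R] (s t : σ) (F : (σ → R) → R) (z : σ → R) :
    R :=
  F z - partialDiff s F z - partialDiff t F z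

theorem pairOp_comp_sub {σ R : Type*} [DecidableEq σ] [CommRing R] (s t : σ) (F : (σ → R) → R)
    (v : σ → R) : pairOp s t (fun z => F (z - v)) = fun z => pairOp s t F (z - v) := by
  funext z
  simp only [pairOp, partialDiff, add_sub_right_comm]

theorem IsMultiaffine.pairOp {σ R : Type*} [DecidableEq σ] [CommRing R] {F : (σ → R) → R}
    (hF : IsMultiaffine F) (s t : σ) : IsMultiaffine (pairOp s t F) :=
  (hF.sub (hF.diff s)).sub (hF.diff t)

section

variable {σ : Type*} [DecidableEq σ] {f : (σ → ℝ) → ℝ} {b : σ → ℝ} {s t : σ}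

theorem partialDiff_pairOp (f : (σ → ℝ) → ℝ) (w s t : σ) (x : σ → ℝ) :
    partialDiff w (pairOp s t f) x = pairOp s t (partialDiff w f) x := by
  rw [pairOp, partialDiff_comm s w, partialDiff_comm t w]
  simp only [partialDiff, pairOp]
  ring

theorem IsMultiaffine.apply_add_pair (hf : IsMultiaffine f) (x : σ → ℝ) (τ : ℝ) :
    f (x + Pi.single s τ + Pi.single t τ) =
      f x + (partialDiff s f x + partialDiff t f x) * τ +
        partialDiff s (partialDiff t f) x * τ ^ 2 := by
  rw [hf t, hf s, hf.diff t s]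
  ring

theorem IsMultiaffine.diff_add_pair (hf : IsMultiaffine f) (x : σ → ℝ) (τ : ℝ) :
    partialDiff s f (x + Pi.single s τ + Pi.single t τ) +
        partialDiff t f (x + Pi.single s τ + Pi.single t τ) =
      partialDiff s f x + partialDiff t f x + 2 * partialDiff s (partialDiff t f) x * τ := by
  rw [hf.partialDiff_add_single_self t, hf.diff t s, add_right_comm,
    hf.partialDiff_add_single_self s, hf.diff s t, partialDiff_comm t s]
  ring

theorem IsRayleigh.barrier_pair_le [Fintype σ] (hf : IsRayleigh f) (hb : PosAbove f b)
    {c : ℝ} (h : partialDiff s f b + partialDiff t f b ≤ c * f b) {y : σ → ℝ} (hy : b ≤ y) :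
    partialDiff s f y + partialDiff t f y ≤ c * f y := by
  have h1 := hf.barrier_antitone hb s le_rfl hy
  have h2 := hf.barrier_antitone hb t le_rfl hy
  rw [← div_le_iff₀ (hb b le_rfl), add_div] at h
  rw [← div_le_iff₀ (hb y hy), add_div]
  linarith

theorem IsRayleigh.pairOp_posAbove [Fintype σ] (hf : IsRayleigh f) (hb : PosAbove f b) {c : ℝ}
    (hc : c < 1) (h : partialDiff s f b + partialDiff t f b ≤ c * f b) :
    PosAbove (pairOp s t f) b := by
  intro y hy
  have h1 := hf.barrier_pair_le hb h hy
  have h2 := mul_pos (sub_pos.2 hc) (hb y hy)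
  rw [pairOp]
  linarith

/-- One step of the barrier argument: applying `1 - ∂ₛ - ∂ₜ` and moving up in the directions `s`
and `t` does not increase the barrier function of another coordinate. -/
theorem IsRayleigh.barrier_pairOp_le [Fintype σ] (hf : IsRayleigh f) (hb : PosAbove f b) {a : ℝ}
    (ha : 0 < a) (h : partialDiff s f b + partialDiff t f b ≤ (1 - 1 / a) * f b)
    {w : σ} (hws : w ≠ s) (hwt : w ≠ t) {c : ℝ} (hw : partialDiff w f b ≤ c * f b) :
    partialDiff w (pairOp s t f) (b + Pi.single s a + Pi.single t a) ≤
      c * pairOp s t f (b + Pi.single s a + Pi.single t a) := by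
  set x := b + Pi.single s a + Pi.single t a with hx
  have hbx : b ≤ x := le_add_single (le_add_single le_rfl s ha.le) t ha.le
  have hxa : x + Pi.single s (-a) + Pi.single t (-a) = b := by
    simp only [hx, Pi.single_neg]
    abel
  have hmem : ∀ τ, -a ≤ τ → b ≤ x + Pi.single s τ + Pi.single t τ := by
    intro τ hτ
    have h1 : x + Pi.single s τ + Pi.single t τ =
        b + Pi.single s (a + τ) + Pi.single t (a + τ) := by
      simp only [hx, Pi.single_add]
      abel
    rw [h1]
    exact le_add_single (le_add_single le_rfl s (by linarith)) t (by linarith)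
  have hfb := hf.affine.apply_add_pair (s := s) (t := t) x (-a)
  have hNb := (hf.affine.diff w).apply_add_pair (s := s) (t := t) x (-a)
  have hDb := hf.affine.diff_add_pair (s := s) (t := t) x (-a)
  rw [hxa] at hfb hNb hDb
  have hpos := hb b le_rfl
  have hn : ∀ y, b ≤ y → 0 ≤ f y := fun y hy => (hb y hy).le
  have hn' : ∀ y, b ≤ y → 0 ≤ partialDiff t f y := fun y hy =>
    hf.affine.partialDiff_nonneg hn t hy
  -- P and N are the restrictions of f and ∂_w f to the diagonal line x + τ(eₛ + eₜ); τ = 0 is the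
  -- new vertex x and τ = -a the old vertex b.
  have key := quadratic_barrier (P0 := f x) (P1 := partialDiff s f x + partialDiff t f x)
    (P2 := partialDiff s (partialDiff t f) x) (N0 := partialDiff w f x)
    (N1 := partialDiff s (partialDiff w f) x + partialDiff t (partialDiff w f) x)
    (N2 := partialDiff s (partialDiff t (partialDiff w f)) x) ha
    (by
      intro τ
      rw [← hf.affine.apply_add_pair, ← (hf.affine.diff w).apply_add_pair,
        ← hf.affine.diff_add_pair, ← (hf.affine.diff w).diff_add_pair]
      have h1 := hf.rayleigh s w (x + Pi.single s τ + Pi.single t τ) hws.symm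
      have h2 := hf.rayleigh t w (x + Pi.single s τ + Pi.single t τ) hwt.symm
      linarith)
    (by
      intro τ hτ
      rw [← hf.affine.apply_add_pair]
      exact hb _ (hmem τ hτ))
    ((hf.affine.diff t).partialDiff_nonneg hn' s hbx)
    (by
      have h1 := hf.affine.partialDiff_nonneg hn s (le_refl b)
      have h2 := hn' b le_rfl
      linarith)
    (by
      have h1 := hf.barrier_pair_le hb h hbx
      have h2 := mul_le_mul_of_nonneg_left h1 ha.le
      have h3 : a * ((1 - 1 / a) * f x) = a * f x - f x := by field_simp
      linarith)
  have hg : 0 < pairOp s t f x := by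
    refine hf.pairOp_posAbove hb (c := 1 - 1 / a) ?_ h x hbx
    have := one_div_pos.2 ha
    linarith
  have e1 : f x - (partialDiff s f x + partialDiff t f x) = pairOp s t f x := by
    rw [pairOp]; ring
  have e2 : partialDiff w f x -
      (partialDiff s (partialDiff w f) x + partialDiff t (partialDiff w f) x) =
      partialDiff w (pairOp s t f) x := by
    rw [partialDiff_pairOp, pairOp]; ring
  rw [e1, e2] at key
  have e3 : partialDiff w (pairOp s t f) x * f b ≤ partialDiff w f b * pairOp s t f x := by
    rw [hfb, hNb]
    linarith
  have e4 := mul_le_mul_of_nonneg_right hw hg.le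
  refine le_of_mul_le_mul_right ?_ hpos
  linarith

/-- If `1 - ∂ₛ - ∂ₜ` maps `f` to a function that is positive above `b`, and `f` is positive far out,
then `f` is positive above `b`. -/
theorem IsRayleigh.posAbove_of_pairOp [Fintype σ] (hf : IsRayleigh f) {c : σ → ℝ} (hbc : b ≤ c)
    (hc : PosAbove f c) (hb : PosAbove (pairOp s t f) b) : PosAbove f b := by
  -- The vertex is lowered from c to b one coordinate at a time.
  have key : ∀ S : Finset σ, PosAbove f (fun i => if i ∈ S then b i else c i) := by
    intro S
    induction S using Finset.induction_on with
    | empty => simpa using hc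
    | insert j S hj ih =>
      intro y hy
      have hby : b ≤ y := by
        refine le_trans (fun i => ?_) hy
        dsimp only
        split_ifs
        exacts [le_rfl, hbc i]
      by_contra! hfy
      have hup : 0 < f (y + Pi.single j (c j - b j)) := by
        refine ih _ fun i => ?_
        have h1 := hy i
        by_cases hij : i = j
        · subst hij
          simp only [Finset.mem_insert_self, if_true] at h1
          simp only [hj, if_false, Pi.add_apply, Pi.single_eq_same]
          linarith
        · simpa [Finset.mem_insert, hij] using h1
      have hr : 0 ≤ c j - b j := sub_nonneg.2 (hbc j)
      have haff := hf.affine j y (c j - b j)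
      have hD : 0 < partialDiff j f y := by
        by_contra! hD
        have := mul_nonpos_of_nonneg_of_nonpos hr hD
        linarith
      obtain ⟨r, hr0, hfr⟩ : ∃ r : ℝ, 0 ≤ r ∧ f (y + Pi.single j r) = 0 := by
        refine ⟨-f y / partialDiff j f y, div_nonneg (by linarith) hD.le, ?_⟩
        rw [hf.affine]
        field_simp
        ring
      have hDj : partialDiff j f (y + Pi.single j r) = partialDiff j f y :=
        hf.affine.partialDiff_add_single_self j y r
      -- At a zero of f the Rayleigh inequality reads 0 ≤ ∂ᵢf ∂ⱼf. With ∂ⱼf > 0 all partial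
      -- derivatives are nonnegative, so f - ∂ₛf - ∂ₜf ≤ 0 there, against `hb`.
      have hnn : ∀ i, 0 ≤ partialDiff i f (y + Pi.single j r) := by
        intro i
        by_cases hij : i = j
        · rw [hij, hDj]
          exact hD.le
        · have h1 := hf.rayleigh i j (y + Pi.single j r) hij
          rw [hfr, zero_mul, hDj] at h1
          exact nonneg_of_mul_nonneg_left h1 hD
      have h2 := hb _ (le_add_single hby j hr0)
      rw [pairOp, hfr] at h2
      linarith [hnn s, hnn t]
  simpa using key Finset.univ

/-- One of the two summands of `1 - ∂ₛ - ∂ₜ = ((1 - 2 ∂ₛ) + (1 - 2 ∂ₜ)) / 2` preserves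
positivity. -/
theorem IsRayleigh.exists_posAbove_sub_single [Fintype σ] (hf : IsRayleigh f) {c : σ → ℝ}
    (hbc : b ≤ c) (hc : PosAbove f c) (hb : PosAbove (pairOp s t f) b) :
    PosAbove (fun z => f (z - Pi.single s 2)) b ∨ PosAbove (fun z => f (z - Pi.single t 2)) b := by
  have hpos := hf.posAbove_of_pairOp hbc hc hb
  have main : ∀ i, 2 * partialDiff i f b < f b →
      PosAbove (fun z => f (z - Pi.single i 2)) b := by
    intro i hi y hy
    have h1 := hf.barrier_antitone hpos i le_rfl hy
    have h2 : partialDiff i f b / f b < 1 / 2 := by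
      rw [div_lt_iff₀ (hpos b le_rfl)]
      linarith
    have h3 := (div_lt_iff₀ (hpos y hy)).1 (h1.trans_lt h2)
    simp only [hf.affine.apply_sub_single]
    linarith
  -- f - 2∂ₛf and f - 2∂ₜf have positive average at b, so one of them is positive there; `main`
  -- carries this to the whole orthant, because the barrier only decreases.
  have h0 := hb b le_rfl
  rw [pairOp] at h0
  rcases lt_or_ge (2 * partialDiff s f b) (f b) with h | h
  · exact Or.inl (main s h)
  · exact Or.inr (main t (by linarith))

end

/-! ### Real stability implies the Rayleigh inequality -/

/-- A multiaffine function with real coefficients that has no zeros with all coordinates in the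
open upper half plane. -/
structure IsRealStable {σ : Type*} [DecidableEq σ] (F : (σ → ℂ) → ℂ) : Prop where
  continuous : Continuous F
  affine : IsMultiaffine F
  real : ∀ x : σ → ℝ, (F fun i => (x i : ℂ)).im = 0
  ne_zero : ∀ z : σ → ℂ, (∀ i, 0 < (z i).im) → F z ≠ 0

/-- The real part of the restriction of `F` to real points. -/
def realRestrict {σ : Type*} (F : (σ → ℂ) → ℂ) (x : σ → ℝ) : ℝ :=
  (F fun i => (x i : ℂ)).re

theorem realRestrict_comp_sub {σ : Type*} (F : (σ → ℂ) → ℂ) (v : σ → ℝ) :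
    realRestrict (fun z => F (z - fun i => (v i : ℂ))) = fun x => realRestrict F (x - v) := by
  funext x
  simp only [realRestrict]
  congr 2
  funext i
  simp

section

variable {σ : Type*} [DecidableEq σ] {F : (σ → ℂ) → ℂ}

theorem ofReal_add_single (x : σ → ℝ) (i : σ) (r : ℝ) :
    (fun j => ((x + Pi.single i r : σ → ℝ) j : ℂ)) =
      (fun j => (x j : ℂ)) + Pi.single i (r : ℂ) := by
  funext j
  by_cases h : j = i
  · subst h; simp
  · simp [h]

theorem partialDiff_realRestrict (i : σ) (F : (σ → ℂ) → ℂ) :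
    partialDiff i (realRestrict F) = realRestrict (partialDiff i F) := by
  funext x
  simp only [partialDiff, realRestrict, ofReal_add_single, Complex.ofReal_one, Complex.sub_re]

theorem pairOp_realRestrict (s t : σ) (F : (σ → ℂ) → ℂ) :
    pairOp s t (realRestrict F) = realRestrict (pairOp s t F) := by
  funext x
  simp only [pairOp, partialDiff_realRestrict]
  simp [realRestrict, pairOp]

namespace IsRealStable

theorem continuous_partialDiff (hF : IsRealStable F) (i : σ) : Continuous (partialDiff i F) :=
  (hF.continuous.comp (continuous_id.add continuous_const)).sub hF.continuous

theorem partialDiff_im (hF : IsRealStable F) (i : σ) (x : σ → ℝ) :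
    (partialDiff i F fun j => (x j : ℂ)).im = 0 := by
  rw [partialDiff, Complex.sub_im, hF.real, ← Complex.ofReal_one, ← ofReal_add_single, hF.real,
    sub_zero]

theorem comp_sub (hF : IsRealStable F) (v : σ → ℝ) :
    IsRealStable (fun z => F (z - fun i => (v i : ℂ))) where
  continuous := hF.continuous.comp (continuous_id.sub continuous_const)
  affine := hF.affine.comp_sub _
  real x := by
    rw [show ((fun i => (x i : ℂ)) - fun i => (v i : ℂ)) = fun i => (((x - v) i : ℝ) : ℂ) by
      funext i; simp]
    exact hF.real _
  ne_zero z hz := hF.ne_zero _ fun i => by simpa using hz i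

open ComplexConjugate

/-- As a function of the increment w of coordinate i, F has the zero -F/∂ᵢF, which stability forces
into the open lower half plane. -/
theorem im_mul_conj_neg (hF : IsRealStable F) (i : σ) {z : σ → ℂ} (hz : ∀ i, 0 < (z i).im) :
    partialDiff i F z = 0 ∨ (partialDiff i F z * conj (F z)).im < 0 := by
  refine or_iff_not_imp_left.2 fun hB => ?_
  obtain ⟨w, hw⟩ : ∃ w, w = -F z / partialDiff i F z := ⟨_, rfl⟩
  have hFw : F z = -w * partialDiff i F z := by
    rw [hw]
    field_simp
  have h0 : F (z + Pi.single i w) = 0 := by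
    rw [hF.affine, hFw]
    ring
  have him : w.im < 0 := by
    by_contra! h
    refine hF.ne_zero _ (fun j => ?_) h0
    by_cases hj : j = i
    · subst hj
      simpa using add_pos_of_pos_of_nonneg (hz j) h
    · simpa [hj] using hz j
  have h1 : partialDiff i F z * conj (F z) =
      ((Complex.normSq (partialDiff i F z) : ℝ) : ℂ) * -conj w := by
    rw [hFw, map_mul, Complex.normSq_eq_conj_mul_self, map_neg]
    ring
  rw [h1, Complex.im_ofReal_mul, Complex.neg_im, Complex.conj_im, neg_neg]
  exact mul_neg_of_pos_of_neg (Complex.normSq_pos.2 hB) him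

theorem im_mul_conj_nonpos (hF : IsRealStable F) (i : σ) {z : σ → ℂ} (hz : ∀ i, 0 ≤ (z i).im) :
    (partialDiff i F z * conj (F z)).im ≤ 0 := by
  let p : ℝ → (σ → ℂ) := fun ε => z + fun _ => (ε : ℂ) * Complex.I
  have hp : Continuous p := by fun_prop
  have hg : Continuous fun ε => (partialDiff i F (p ε) * conj (F (p ε))).im :=
    Complex.continuous_im.comp (((hF.continuous_partialDiff i).comp hp).mul
      (Complex.continuous_conj.comp (hF.continuous.comp hp)))
  have h0 : p 0 = z := by
    funext j
    simp [p]
  rw [← h0]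
  refine le_of_tendsto ((hg.tendsto 0).mono_left (nhdsWithin_le_nhds (s := Set.Ioi 0))) ?_
  filter_upwards [self_mem_nhdsWithin] with ε hε
  rcases hF.im_mul_conj_neg i (z := p ε) (fun j => by
    simpa [p] using add_pos_of_nonneg_of_pos (hz j) hε) with h | h
  · simp [h]
  · exact h.le

/-- After multiplication by conj F, each nonzero derivative term contributes a positive imaginary
part, so nothing cancels; if both derivatives vanish, F itself remains. -/
theorem pairOp (hF : IsRealStable F) (s t : σ) : IsRealStable (pairOp s t F) where
  continuous := (hF.continuous.sub (hF.continuous_partialDiff s)).sub (hF.continuous_partialDiff t)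
  affine := hF.affine.pairOp s t
  real x := by
    simp only [_root_.pairOp, Complex.sub_im, hF.real, hF.partialDiff_im, sub_zero]
  ne_zero z hz h := by
    have hFz := hF.ne_zero z hz
    have h1 : F z * conj (F z) - partialDiff s F z * conj (F z) -
        partialDiff t F z * conj (F z) = 0 := by
      rw [← sub_mul, ← sub_mul]
      exact mul_eq_zero_of_left h _
    have h2 := congrArg Complex.im h1
    rw [Complex.mul_conj] at h2
    simp only [Complex.sub_im, Complex.ofReal_im, Complex.zero_im] at h2
    rcases hF.im_mul_conj_neg s hz with hs | hs <;> rcases hF.im_mul_conj_neg t hz with ht | ht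
    · rw [_root_.pairOp, hs, ht] at h
      exact hFz (by simpa using h)
    all_goals first | rw [hs] at h2 | skip
    all_goals first | rw [ht] at h2 | skip
    all_goals first | simp only [zero_mul, Complex.zero_im] at h2 | skip
    all_goals linarith

theorem isRayleigh (hF : IsRealStable F) : IsRayleigh (realRestrict F) where
  affine i x r := by
    rw [partialDiff_realRestrict]
    simp only [realRestrict, ofReal_add_single]
    rw [hF.affine, Complex.add_re, Complex.re_ofReal_mul]
  rayleigh i j x hij := by
    rw [partialDiff_realRestrict, partialDiff_realRestrict, partialDiff_realRestrict]
    obtain ⟨X, hX⟩ : ∃ X : σ → ℂ, X = fun i => (x i : ℂ) := ⟨_, rfl⟩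
    -- At x + I eⱼ, affinity gives F + I ∂ⱼF and ∂ᵢF + I ∂ᵢ∂ⱼF with real entries, and the imaginary
    -- part of the product is F ∂ᵢ∂ⱼF - ∂ᵢF ∂ⱼF.
    have h := hF.im_mul_conj_nonpos i (z := X + Pi.single j Complex.I) (fun k => by
      by_cases hk : k = j
      · subst hk; simp [hX]
      · simp [hX, hk])
    have hij' : (partialDiff i (partialDiff j F) X).im = 0 := by
      rw [partialDiff, Complex.sub_im, hX, hF.partialDiff_im, ← Complex.ofReal_one,
        ← ofReal_add_single, hF.partialDiff_im, sub_zero]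
    have e1 := hF.real x
    have e2 := hF.partialDiff_im i x
    have e3 := hF.partialDiff_im j x
    rw [hF.affine, hF.affine.diff i, partialDiff_comm j i] at h
    simp only [realRestrict]
    rw [← hX] at e1 e2 e3 ⊢
    simp [e1, e2, e3, hij'] at h
    linarith

end IsRealStable

end

/-! ### Iterating over all indices -/

section PairList

variable {ι : Type*} [DecidableEq ι]

/-- The product of the operators `1 - ∂₍ᵢ,₀₎ - ∂₍ᵢ,₁₎` over a list of indices `i`. -/
def pairOpList {R : Type*} [CommRing R] (l : List ι) (F : (ι × Bool → R) → R) :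
    (ι × Bool → R) → R :=
  l.foldr (fun i G => pairOp (i, true) (i, false) G) F

theorem pairOpList_cons {R : Type*} [CommRing R] (i : ι) (l : List ι)
    (F : (ι × Bool → R) → R) :
    pairOpList (i :: l) F = pairOp (i, true) (i, false) (pairOpList l F) := rfl

theorem pairOpList_realRestrict (l : List ι) (F : (ι × Bool → ℂ) → ℂ) :
    pairOpList l (realRestrict F) = realRestrict (pairOpList l F) := by
  induction l with
  | nil => rfl
  | cons i l ih => rw [pairOpList_cons, ih, pairOp_realRestrict, pairOpList_cons]

theorem pairOpList_comp_sub {R : Type*} [CommRing R] (l : List ι) (F : (ι × Bool → R) → R)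
    (v : ι × Bool → R) :
    pairOpList l (fun z => F (z - v)) = fun z => pairOpList l F (z - v) := by
  induction l with
  | nil => rfl
  | cons i l ih => rw [pairOpList_cons, ih, pairOp_comp_sub, pairOpList_cons]

theorem IsRealStable.pairOpList {F : (ι × Bool → ℂ) → ℂ} (hF : IsRealStable F) (l : List ι) :
    IsRealStable (pairOpList l F) := by
  induction l with
  | nil => exact hF
  | cons i l ih => exact ih.pairOp _ _

theorem IsRealStable.isRayleigh_pairOpList {F : (ι × Bool → ℂ) → ℂ} (hF : IsRealStable F)
    (l : List ι) : IsRayleigh (_root_.pairOpList l (realRestrict F)) := by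
  rw [pairOpList_realRestrict]
  exact (hF.pairOpList l).isRayleigh

theorem posAbove_pairOp {σ : Type*} [DecidableEq σ] {f : (σ → ℝ) → ℝ} (hf : IsMultiaffine f)
    {c : σ → ℝ} (hc : PosAbove f c) (s t : σ) :
    PosAbove (pairOp s t f) (c + Pi.single s 2 + Pi.single t 2) := by
  intro y hy
  have h1 : 0 < f (y - Pi.single s 2) := by
    refine hc _ (le_sub_iff_add_le.2 (le_trans ?_ hy))
    exact le_add_of_nonneg_right (Pi.single_nonneg.2 zero_le_two)
  have h2 : 0 < f (y - Pi.single t 2) := by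
    refine hc _ (le_sub_iff_add_le.2 (le_trans ?_ hy))
    rw [add_right_comm]
    exact le_add_of_nonneg_right (Pi.single_nonneg.2 zero_le_two)
  rw [hf.apply_sub_single] at h1 h2
  rw [pairOp]
  linarith

/-- Supplies the far-out positivity that `IsRayleigh.exists_posAbove_sub_single` requires; how far
out is irrelevant. -/
theorem IsRealStable.exists_posAbove_pairOpList {F : (ι × Bool → ℂ) → ℂ} (hF : IsRealStable F)
    {b c : ι × Bool → ℝ} (hbc : b ≤ c) (hc : PosAbove (realRestrict F) c) (l : List ι) :
    ∃ c', b ≤ c' ∧ PosAbove (_root_.pairOpList l (realRestrict F)) c' := by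
  induction l with
  | nil => exact ⟨c, hbc, hc⟩
  | cons i l ih =>
    obtain ⟨c', hbc', hc'⟩ := ih
    exact ⟨_, le_add_single (le_add_single hbc' _ zero_le_two) _ zero_le_two,
      posAbove_pairOp (hF.isRayleigh_pairOpList l).affine hc' _ _⟩

/-- The barrier argument. -/
theorem IsRealStable.barrier_pairOpList [Fintype ι] {F : (ι × Bool → ℂ) → ℂ}
    (hF : IsRealStable F) (h0 : PosAbove (realRestrict F) 0) {φ a : ℝ} (ha : 0 < a)
    (hφ : 2 * φ ≤ 1 - 1 / a)
    (hbar : ∀ w, partialDiff w (realRestrict F) 0 ≤ φ * realRestrict F 0) {l : List ι}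
    (hl : l.Nodup) :
    PosAbove (_root_.pairOpList l (realRestrict F)) (fun p => if p.1 ∈ l then a else 0) ∧
      ∀ w, w.1 ∉ l →
        partialDiff w (_root_.pairOpList l (realRestrict F)) (fun p => if p.1 ∈ l then a else 0) ≤
          φ * _root_.pairOpList l (realRestrict F) (fun p => if p.1 ∈ l then a else 0) := by
  induction l with
  | nil =>
    simp only [List.not_mem_nil, if_false]
    exact ⟨h0, fun w _ => hbar w⟩
  | cons i l ih =>
    obtain ⟨hil, hl'⟩ := List.nodup_cons.1 hl
    obtain ⟨ih1, ih2⟩ := ih hl'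
    have hb : (fun p : ι × Bool => if p.1 ∈ i :: l then a else 0) =
        (fun p => if p.1 ∈ l then a else 0) + Pi.single (i, true) a + Pi.single (i, false) a := by
      funext ⟨j, k⟩
      by_cases hj : j = i
      · subst hj
        cases k <;> simp [hil]
      · simp [hj]
    have hR := hF.isRayleigh_pairOpList l
    have hsum := add_le_add (ih2 (i, true) hil) (ih2 (i, false) hil)
    rw [← two_mul, ← mul_assoc] at hsum
    have hsum' := hsum.trans (mul_le_mul_of_nonneg_right hφ (ih1 _ le_rfl).le)
    have h1a : 1 - 1 / a < 1 := sub_lt_self _ (one_div_pos.2 ha)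
    rw [hb, pairOpList_cons]
    refine ⟨(hR.pairOp_posAbove ih1 h1a hsum').mono
      (le_add_single (le_add_single le_rfl _ ha.le) _ ha.le), fun w hw => ?_⟩
    rw [List.mem_cons, not_or] at hw
    refine hR.barrier_pairOp_le ih1 ha hsum' ?_ ?_ (ih2 w hw.2)
    · rintro rfl
      exact hw.1 rfl
    · rintro rfl
      exact hw.1 rfl

/-- If the average of the shifts of `F` over all choices is positive above `b`, then so is one of
the shifts. -/
theorem IsRealStable.exists_selection [Fintype ι] {l : List ι} (hl : l.Nodup) :
    ∀ {F : (ι × Bool → ℂ) → ℂ}, IsRealStable F → ∀ {b c : ι × Bool → ℝ}, b ≤ c →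
      PosAbove (realRestrict F) c → PosAbove (_root_.pairOpList l (realRestrict F)) b →
      ∃ χ : ι → Bool, PosAbove (fun x => realRestrict F
        (x - fun p => if p.1 ∈ l ∧ χ p.1 = p.2 then 2 else 0)) b := by
  induction l with
  | nil =>
    intro F hF b c hbc hc hb
    refine ⟨fun _ => true, fun y hy => ?_⟩
    have h : y - (fun p : ι × Bool => if p.1 ∈ ([] : List ι) ∧ true = p.2 then (2 : ℝ) else 0) =
        y := by
      funext p
      simp
    beta_reduce
    rw [h]
    exact hb y hy
  | cons i l ih =>
    intro F hF b c hbc hc hb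
    obtain ⟨hil, hl'⟩ := List.nodup_cons.1 hl
    obtain ⟨c', hbc', hc'⟩ := hF.exists_posAbove_pairOpList hbc hc l
    have hsel : ∃ k, PosAbove (fun z => _root_.pairOpList l (realRestrict F)
        (z - Pi.single (i, k) 2)) b := by
      rcases (hF.isRayleigh_pairOpList l).exists_posAbove_sub_single hbc' hc' hb with h | h
      exacts [⟨_, h⟩, ⟨_, h⟩]
    obtain ⟨k, hk⟩ := hsel
    -- The chosen shift commutes with the remaining operators, so it is absorbed into F before the
    -- induction hypothesis is applied.
    rw [← pairOpList_comp_sub, ← realRestrict_comp_sub] at hk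
    have hc2 : PosAbove (realRestrict fun z => F (z - fun j =>
        ((Pi.single (i, k) (2 : ℝ) : ι × Bool → ℝ) j : ℂ))) (c + Pi.single (i, k) 2) := by
      rw [realRestrict_comp_sub]
      exact fun y hy => hc _ (le_sub_iff_add_le.2 hy)
    obtain ⟨χ, hχ⟩ := ih hl' (hF.comp_sub _) (le_add_single hbc (i, k) zero_le_two) hc2 hk
    refine ⟨Function.update χ i k, fun y hy => ?_⟩
    have h := hχ y hy
    rw [realRestrict_comp_sub] at h
    convert h using 2
    beta_reduce
    rw [sub_sub]
    congr 2
    funext ⟨j, m⟩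
    by_cases hj : j = i
    · subst hj
      by_cases hm : m = k
      · subst hm; simp [hil]
      · simp [hil, hm, Ne.symm hm]
    · simp [hj]

end PairList

/-! ### Two copies of the variables, one for each class -/

section Doubled

variable {ι : Type*} [DecidableEq ι]

/-- The function `(z, z') ↦ Q z * Q z'`. -/
def doubled {R : Type*} [CommRing R] (Q : (ι → R) → R) (z : ι × Bool → R) : R :=
  Q (fun i => z (i, true)) * Q (fun i => z (i, false))

theorem slice_add_single {R : Type*} [CommRing R] (z : ι × Bool → R) (j : ι) (k l : Bool) (w : R) :
    (fun i => (z + Pi.single (j, k) w : ι × Bool → R) (i, l)) =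
      if l = k then (fun i => z (i, l)) + Pi.single j w else fun i => z (i, l) := by
  funext i
  by_cases hl : l = k
  · subst hl
    by_cases hi : i = j
    · subst hi; simp
    · simp [hi]
  · simp [hl]

theorem doubled_add_single_true {R : Type*} [CommRing R] (Q : (ι → R) → R) (z : ι × Bool → R)
    (j : ι) (w : R) : doubled Q (z + Pi.single (j, true) w) =
      Q ((fun i => z (i, true)) + Pi.single j w) * Q (fun i => z (i, false)) := by
  rw [doubled, slice_add_single, slice_add_single]
  simp

theorem doubled_add_single_false {R : Type*} [CommRing R] (Q : (ι → R) → R) (z : ι × Bool → R)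
    (j : ι) (w : R) : doubled Q (z + Pi.single (j, false) w) =
      Q (fun i => z (i, true)) * Q ((fun i => z (i, false)) + Pi.single j w) := by
  rw [doubled, slice_add_single, slice_add_single]
  simp

theorem partialDiff_doubled {R : Type*} [CommRing R] (Q : (ι → R) → R) (z : ι × Bool → R)
    (j : ι) (k : Bool) : partialDiff (j, k) (doubled Q) z =
      partialDiff j Q (fun i => z (i, k)) * Q (fun i => z (i, !k)) := by
  cases k
  · rw [partialDiff, doubled_add_single_false, partialDiff, doubled]
    simp only [Bool.not_false]
    ring
  · rw [partialDiff, doubled_add_single_true, partialDiff, doubled]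
    simp only [Bool.not_true]
    ring

theorem IsRealStable.doubled {Q : (ι → ℂ) → ℂ} (hQ : IsRealStable Q) :
    IsRealStable (doubled Q) where
  continuous := by
    have h := hQ.continuous
    unfold _root_.doubled
    fun_prop
  affine := by
    rintro ⟨j, k⟩ z w
    rw [partialDiff_doubled]
    cases k
    · rw [doubled_add_single_false, hQ.affine, _root_.doubled, Bool.not_false]
      ring
    · rw [doubled_add_single_true, hQ.affine, _root_.doubled, Bool.not_true]
      ring
  real x := by
    rw [_root_.doubled, Complex.mul_im, hQ.real fun i => x (i, true),
      hQ.real fun i => x (i, false)]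
    ring
  ne_zero z hz := mul_ne_zero (hQ.ne_zero _ fun i => hz _) (hQ.ne_zero _ fun i => hz _)

theorem IsRealStable.realRestrict_doubled {Q : (ι → ℂ) → ℂ} (hQ : IsRealStable Q)
    (x : ι × Bool → ℝ) : realRestrict (_root_.doubled Q) x =
      realRestrict Q (fun i => x (i, true)) * realRestrict Q (fun i => x (i, false)) := by
  simp only [realRestrict, _root_.doubled]
  rw [Complex.mul_re, hQ.real fun i => x (i, true), zero_mul, sub_zero]

end Doubled

/-! ### The determinant polynomial and semidefiniteness -/

section Determinant

open Matrix ComplexOrder ComplexConjugate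

variable {m ι : Type*} [DecidableEq m] [Fintype ι] [DecidableEq ι]

theorem isHermitian_one_add_conj_diagonal (B : Matrix m ι ℂ) (x : ι → ℝ) :
    (1 + B * diagonal (fun i => (x i : ℂ)) * Bᴴ).IsHermitian := by
  refine isHermitian_one.add (isHermitian_mul_mul_conjTranspose B ?_)
  rw [isHermitian_diagonal_iff]
  intro i
  exact Complex.conj_ofReal _

variable [Fintype m]

/-- A pencil that starts at a positive definite matrix and stays nonsingular ends at a positive
semidefinite matrix. -/
theorem posSemidef_sub_smul_of_det_ne_zero {P K : Matrix m m ℂ} (hP : P.PosDef)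
    (hK : K.IsHermitian) {R : ℝ} (hR : 0 ≤ R)
    (h : ∀ s : ℝ, 0 ≤ s → s ≤ R → (P - (s : ℂ) • K).det ≠ 0) : (P - (R : ℂ) • K).PosSemidef := by
  obtain ⟨C, hC⟩ : ∃ C : Matrix m m ℂ, P = Cᴴ * C := by
    open scoped MatrixOrder in
    exact CStarAlgebra.nonneg_iff_eq_star_mul_self.mp hP.posSemidef.nonneg
  have hCu : IsUnit C.det := by
    have h1 := hP.det_pos.ne'
    rw [hC, det_mul] at h1
    exact isUnit_iff_ne_zero.2 (right_ne_zero_of_mul h1)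
  obtain ⟨L, hL⟩ : ∃ L, L = (C⁻¹)ᴴ * K * C⁻¹ := ⟨_, rfl⟩
  have hLK : Cᴴ * L * C = K := by
    have h1 : C⁻¹ * C = 1 := nonsing_inv_mul C hCu
    have h2 : Cᴴ * (C⁻¹)ᴴ = 1 := by rw [← conjTranspose_mul, h1, conjTranspose_one]
    calc Cᴴ * L * C = (Cᴴ * (C⁻¹)ᴴ) * K * (C⁻¹ * C) := by rw [hL]; simp only [Matrix.mul_assoc]
      _ = K := by rw [h1, h2, Matrix.one_mul, Matrix.mul_one]
  have hLh : L.IsHermitian := by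
    rw [hL]
    exact isHermitian_conjTranspose_mul_mul _ hK
  have hfac : ∀ s : ℝ, P - (s : ℂ) • K = Cᴴ * (1 - (s : ℂ) • L) * C := by
    intro s
    rw [Matrix.mul_sub, Matrix.sub_mul, Matrix.mul_one, ← hC, Matrix.mul_smul, Matrix.smul_mul, hLK]
  have hdet : ∀ s : ℝ, 0 ≤ s → s ≤ R → (1 - (s : ℂ) • L).det ≠ 0 := by
    intro s h0 h1 h2
    refine h s h0 h1 ?_
    rw [hfac, det_mul, det_mul, h2, mul_zero, zero_mul]
  rw [hfac]
  refine PosSemidef.conjTranspose_mul_mul_same ?_ C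
  have hH : (1 - (R : ℂ) • L).IsHermitian := by
    refine isHermitian_one.sub ?_
    rw [IsHermitian, conjTranspose_smul, hLh.eq]
    simp
  rw [hH.posSemidef_iff_eigenvalues_nonneg]
  intro i
  by_contra! hneg
  obtain ⟨μ, hμ⟩ : ∃ μ, μ = hH.eigenvalues i := ⟨_, rfl⟩
  obtain ⟨v, hv⟩ : ∃ v : m → ℂ, v = ⇑(hH.eigenvectorBasis i) := ⟨_, rfl⟩
  have hv0 : v ≠ 0 := by
    intro h0
    refine hH.eigenvectorBasis.toBasis.ne_zero i ?_
    ext j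
    simpa [hv] using congrFun h0 j
  have heig : (1 - (R : ℂ) • L) *ᵥ v = (μ : ℂ) • v := by
    rw [hv, hμ]
    exact hH.mulVec_eigenvectorBasis i
  have hμ0 : μ < 0 := by
    rw [hμ]
    exact hneg
  have hμ1 : (0 : ℝ) < 1 - μ := by linarith
  have hLv : (R : ℂ) • L *ᵥ v = ((1 - μ : ℝ) : ℂ) • v := by
    rw [sub_mulVec, one_mulVec, smul_mulVec, sub_eq_iff_eq_add] at heig
    have : (R : ℂ) • L *ᵥ v = v - (μ : ℂ) • v := eq_sub_of_add_eq' heig.symm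
    rw [this]
    push_cast
    rw [sub_smul, one_smul]
  -- An eigenvalue μ < 0 of 1 - R L gives R L the eigenvalue 1 - μ > 1, so the pencil is already
  -- singular at s = R/(1 - μ) < R or, if R = 0, at s = 0.
  refine hdet (R / (1 - μ)) (by positivity) (div_le_self hR (by linarith)) ?_
  rw [← exists_mulVec_eq_zero_iff]
  refine ⟨v, hv0, ?_⟩
  have hc : ((R / (1 - μ) : ℝ) : ℂ) = (((1 - μ)⁻¹ : ℝ) : ℂ) * (R : ℂ) := by
    push_cast
    rw [div_eq_inv_mul]
  rw [sub_mulVec, one_mulVec, hc, smul_mulVec, mul_smul, hLv, smul_smul, ← Complex.ofReal_mul,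
    inv_mul_cancel₀ hμ1.ne', Complex.ofReal_one, one_smul, sub_self]

/-- The multiaffine function `det (1 + diag(w) G)`. -/
noncomputable def diagDet (G : Matrix ι ι ℂ) (w : ι → ℂ) : ℂ :=
  (1 + diagonal w * G).det

theorem continuous_diagDet (G : Matrix ι ι ℂ) : Continuous (diagDet G) := by
  unfold diagDet
  fun_prop

theorem diagDet_add_single (G : Matrix ι ι ℂ) (w : ι → ℂ) (i : ι) (r : ℂ) :
    diagDet G (w + Pi.single i r) =
      diagDet G w + r * ((1 + diagonal w * G).updateRow i (G i)).det := by
  have h : 1 + diagonal (w + Pi.single i r) * G =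
      (1 + diagonal w * G).updateRow i ((1 + diagonal w * G) i + r • G i) := by
    ext j k
    by_cases hj : j = i
    · subst hj
      simp [diagonal_mul, add_mul, add_assoc]
    · simp [diagonal_mul, hj]
  rw [diagDet, h, det_updateRow_add, det_updateRow_smul, updateRow_eq_self, diagDet]

theorem partialDiff_diagDet (G : Matrix ι ι ℂ) (w : ι → ℂ) (i : ι) :
    partialDiff i (diagDet G) w = ((1 + diagonal w * G).updateRow i (G i)).det := by
  rw [partialDiff, diagDet_add_single]
  ring

theorem diagDet_zero (G : Matrix ι ι ℂ) : diagDet G 0 = 1 := by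
  simp [diagDet]

theorem partialDiff_diagDet_zero (G : Matrix ι ι ℂ) (i : ι) :
    partialDiff i (diagDet G) 0 = G i i := by
  rw [partialDiff_diagDet, ← cramer_transpose_apply]
  simp

theorem diagDet_conjTranspose_mul (B : Matrix m ι ℂ) (w : ι → ℂ) :
    diagDet (Bᴴ * B) w = (1 + B * diagonal w * Bᴴ).det := by
  rw [diagDet, ← Matrix.mul_assoc, det_one_add_mul_comm, ← Matrix.mul_assoc]

theorem posDef_one_add_conj_diagonal (B : Matrix m ι ℂ) {x : ι → ℝ} (hx : 0 ≤ x) :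
    (1 + B * diagonal (fun i => (x i : ℂ)) * Bᴴ).PosDef := by
  refine PosDef.one.add_posSemidef (PosSemidef.mul_mul_conjTranspose_same ?_ B)
  rw [posSemidef_diagonal_iff]
  intro i
  exact_mod_cast hx i

/-- If (1 + diag(z) G)v = 0, then v*Gv = -Σ conj(zᵢ)|(Gv)ᵢ|². The left side is real, so Σ
Im(zᵢ)|(Gv)ᵢ|² = 0, hence Gv = 0 and v = 0. -/
theorem isRealStable_diagDet (B : Matrix m ι ℂ) : IsRealStable (diagDet (Bᴴ * B)) where
  continuous := continuous_diagDet _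
  affine i z w := by rw [diagDet_add_single, partialDiff_diagDet]
  real x := by
    rw [diagDet_conjTranspose_mul, ← Complex.conj_eq_iff_im, ← Complex.star_def,
      ← det_conjTranspose, (isHermitian_one_add_conj_diagonal B x).eq]
  ne_zero z hz h := by
    obtain ⟨G, hG⟩ : ∃ G, G = Bᴴ * B := ⟨_, rfl⟩
    have hGs : G.PosSemidef := by
      rw [hG]
      exact posSemidef_conjTranspose_mul_self B
    rw [← hG, diagDet, ← exists_mulVec_eq_zero_iff] at h
    obtain ⟨v, hv0, hv⟩ := h
    have hvi : ∀ i, v i = -(z i * (G *ᵥ v) i) := by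
      intro i
      have := congrFun hv i
      rw [add_mulVec, one_mulVec, ← mulVec_mulVec, Pi.add_apply, mulVec_diagonal] at this
      exact eq_neg_of_add_eq_zero_left this
    have him := (Complex.nonneg_iff.1 (hGs.dotProduct_mulVec_nonneg v)).2
    have hsum : star v ⬝ᵥ G *ᵥ v =
        ∑ i, -conj (z i) * ((Complex.normSq ((G *ᵥ v) i) : ℝ) : ℂ) := by
      rw [dotProduct]
      refine Finset.sum_congr rfl fun i _ => ?_
      rw [Pi.star_apply, hvi i, Complex.star_def, map_neg, map_mul,
        Complex.normSq_eq_conj_mul_self]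
      ring
    rw [hsum, Complex.im_sum] at him
    have hterm : ∀ i, (-conj (z i) * ((Complex.normSq ((G *ᵥ v) i) : ℝ) : ℂ)).im =
        (z i).im * Complex.normSq ((G *ᵥ v) i) := by
      intro i
      rw [Complex.im_mul_ofReal, Complex.neg_im, Complex.conj_im, neg_neg]
    simp only [hterm] at him
    rw [eq_comm, Finset.sum_eq_zero_iff_of_nonneg fun i _ =>
      mul_nonneg (hz i).le (Complex.normSq_nonneg _)] at him
    refine hv0 (funext fun i => ?_)
    have h1 := him i (Finset.mem_univ i)
    have h2 : (G *ᵥ v) i = 0 :=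
      Complex.normSq_eq_zero.1 ((mul_eq_zero.1 h1).resolve_left (hz i).ne')
    rw [hvi i, h2]
    simp

theorem posAbove_diagDet (B : Matrix m ι ℂ) : PosAbove (realRestrict (diagDet (Bᴴ * B))) 0 := by
  intro x hx
  rw [realRestrict, diagDet_conjTranspose_mul]
  exact (Complex.pos_iff.1 (posDef_one_add_conj_diagonal B hx).det_pos).1

/-- The finite-dimensional partition theorem in terms of Gram matrices. -/
theorem exists_posSemidef_selection (B : Matrix m ι ℂ) {φ a : ℝ} (ha : 0 < a)
    (hφ : 2 * φ ≤ 1 - 1 / a) (hB : ∀ i, ((Bᴴ * B) i i).re ≤ φ) :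
    ∃ χ : ι → Bool, ∀ k, (1 + B * diagonal
      (fun i => ((a - (if χ i = k then 2 else 0) : ℝ) : ℂ)) * Bᴴ).PosSemidef := by
  have hQ := isRealStable_diagDet B
  have hF := hQ.doubled
  have hpos : PosAbove (realRestrict (doubled (diagDet (Bᴴ * B)))) 0 := by
    intro x hx
    rw [hQ.realRestrict_doubled]
    exact mul_pos (posAbove_diagDet B _ fun i => hx _) (posAbove_diagDet B _ fun i => hx _)
  have hbar : ∀ w, partialDiff w (realRestrict (doubled (diagDet (Bᴴ * B)))) 0 ≤
      φ * realRestrict (doubled (diagDet (Bᴴ * B))) 0 := by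
    rintro ⟨i, k⟩
    rw [partialDiff_realRestrict]
    have h0 : (fun i : ι × Bool => (((0 : ι × Bool → ℝ) i : ℝ) : ℂ)) = 0 := by
      funext i
      simp
    have h1 : ∀ l, (fun i : ι => (0 : ι × Bool → ℂ) (i, l)) = 0 := fun l => rfl
    simp only [realRestrict]
    rw [h0, partialDiff_doubled, h1, h1, partialDiff_diagDet_zero, diagDet_zero, doubled, h1, h1,
      diagDet_zero]
    simpa using hB i
  have hnd : (Finset.univ : Finset ι).toList.Nodup := Finset.nodup_toList _
  obtain ⟨hb, -⟩ := hF.barrier_pairOpList hpos ha hφ hbar hnd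
  have hb0 : (0 : ι × Bool → ℝ) ≤ fun p =>
      if p.1 ∈ (Finset.univ : Finset ι).toList then a else 0 := by
    intro p
    simpa using ha.le
  obtain ⟨χ, hχ⟩ := hF.exists_selection hnd le_rfl (hpos.mono hb0) hb
  simp only [Finset.mem_toList, Finset.mem_univ, if_true, true_and] at hχ
  refine ⟨χ, fun k => ?_⟩
  have hdet : ∀ r : ℝ, 0 ≤ r → (1 + B * diagonal
      (fun i => ((a + r - (if χ i = k then 2 else 0) : ℝ) : ℂ)) * Bᴴ).det ≠ 0 := by
    intro r hr h0
    have h1 := hχ (fun _ => a + r) (fun _ => by linarith)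
    beta_reduce at h1
    rw [hQ.realRestrict_doubled] at h1
    have h2 : realRestrict (diagDet (Bᴴ * B))
        (fun i => a + r - (if χ i = k then 2 else 0)) = 0 := by
      rw [realRestrict, diagDet_conjTranspose_mul, h0, Complex.zero_re]
    cases k
    · exact (right_ne_zero_of_mul h1.ne') h2
    · exact (left_ne_zero_of_mul h1.ne') h2
  -- The pencil starts with weights raised by 2, all nonnegative, so the matrix is positive
  -- definite; s = 2 reaches the weights wanted.
  have hpen : ∀ s : ℝ, (1 + B * diagonal
      (fun i => ((a + (2 - s) - (if χ i = k then 2 else 0) : ℝ) : ℂ)) * Bᴴ) =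
      (1 + B * diagonal (fun i => ((a + 2 - (if χ i = k then 2 else 0) : ℝ) : ℂ)) * Bᴴ) -
        (s : ℂ) • (B * Bᴴ) := by
    intro s
    have hd : diagonal (fun i => ((a + (2 - s) - (if χ i = k then 2 else 0) : ℝ) : ℂ)) =
        diagonal (fun i => ((a + 2 - (if χ i = k then 2 else 0) : ℝ) : ℂ)) -
          (s : ℂ) • (1 : Matrix ι ι ℂ) := by
      ext i j
      by_cases hij : i = j
      · subst hij
        simp only [diagonal_apply_eq, Matrix.sub_apply, Matrix.smul_apply, one_apply_eq]
        push_cast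
        simp only [smul_eq_mul]
        ring
      · simp [hij]
    rw [hd, Matrix.mul_sub, Matrix.sub_mul, Matrix.mul_smul, Matrix.mul_one, Matrix.smul_mul,
      add_sub_assoc]
  have hend := posSemidef_sub_smul_of_det_ne_zero (R := 2)
    (posDef_one_add_conj_diagonal B (x := fun i => a + 2 - (if χ i = k then 2 else 0)) (fun i => by
      simp only [Pi.zero_apply]
      split_ifs <;> linarith))
    (isHermitian_mul_conjTranspose_self B) zero_le_two (fun s hs0 hs2 => by
      rw [← hpen s]
      exact hdet _ (by linarith))
  rw [← hpen 2] at hend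
  simpa using hend

end Determinant

/-! ### From matrices to Bessel families and Parseval frames -/

section Hilbert

open Matrix ComplexOrder

/-- The canonical ring homomorphism `x ↦ re x + i im x` to the complex numbers. -/
noncomputable def RCLike.toComplexHom (𝕜 : Type*) [RCLike 𝕜] : 𝕜 →+* ℂ where
  toFun x := ⟨RCLike.re x, RCLike.im x⟩
  map_one' := by apply Complex.ext <;> simp
  map_mul' x y := by apply Complex.ext <;> simp
  map_zero' := by apply Complex.ext <;> simp
  map_add' x y := by apply Complex.ext <;> simp

variable {𝕜 : Type*} [RCLike 𝕜]

theorem RCLike.re_toComplexHom (x : 𝕜) : (RCLike.toComplexHom 𝕜 x).re = RCLike.re x := rfl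

theorem RCLike.toComplexHom_star (x : 𝕜) :
    RCLike.toComplexHom 𝕜 (star x) = star (RCLike.toComplexHom 𝕜 x) := by
  apply Complex.ext <;> simp [RCLike.toComplexHom]

theorem RCLike.norm_toComplexHom_sq (x : 𝕜) : ‖RCLike.toComplexHom 𝕜 x‖ ^ 2 = ‖x‖ ^ 2 := by
  rw [Complex.sq_norm, Complex.normSq_apply, ← RCLike.normSq_eq_def', RCLike.normSq_apply]
  rfl

/-- Testing at the vector Bc leaves an expression in the Gram matrix Bᴴ B only. -/
theorem Matrix.PosSemidef.quadratic_nonneg {m ι : Type*} [Fintype m] [DecidableEq m] [Fintype ι]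
    [DecidableEq ι] {B : Matrix m ι ℂ} {d : ι → ℝ}
    (h : (1 + B * diagonal (fun i => (d i : ℂ)) * Bᴴ).PosSemidef) (c : ι → ℂ) :
    0 ≤ (star c ⬝ᵥ (Bᴴ * B) *ᵥ c).re + ∑ i, d i * ‖((Bᴴ * B) *ᵥ c) i‖ ^ 2 := by
  have h1 := (Complex.nonneg_iff.1 (h.dotProduct_mulVec_nonneg (B *ᵥ c))).1
  have h2 : star (B *ᵥ c) ⬝ᵥ (1 + B * diagonal (fun i => (d i : ℂ)) * Bᴴ) *ᵥ (B *ᵥ c) =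
      star c ⬝ᵥ (Bᴴ * B) *ᵥ c + ∑ i, ((d i * ‖((Bᴴ * B) *ᵥ c) i‖ ^ 2 : ℝ) : ℂ) := by
    rw [add_mulVec, one_mulVec, dotProduct_add]
    congr 1
    · rw [star_mulVec, ← dotProduct_mulVec, mulVec_mulVec]
    · rw [mulVec_mulVec, Matrix.mul_assoc, Matrix.mul_assoc, ← mulVec_mulVec, dotProduct_mulVec,
        star_mulVec, vecMul_vecMul, ← mulVec_mulVec]
      have h3 : star c ᵥ* (Bᴴ * B) = star ((Bᴴ * B) *ᵥ c) := by
        rw [star_mulVec, conjTranspose_mul, conjTranspose_conjTranspose]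
      rw [h3, dotProduct]
      refine Finset.sum_congr rfl fun i _ => ?_
      rw [mulVec_diagonal, Pi.star_apply, Complex.ofReal_mul, Complex.ofReal_pow,
        ← Complex.conj_mul', Complex.star_def]
      ring
  rw [h2, Complex.add_re, ← Complex.ofReal_sum, Complex.ofReal_re] at h1
  exact h1

variable {H : Type*} [NormedAddCommGroup H] [InnerProductSpace 𝕜 H]

theorem exists_selection_of_norm_sq_le {ι : Type*} [Fintype ι] (u : ι → H) {φ a : ℝ} (ha : 0 < a)
    (hφ : 2 * φ ≤ 1 - 1 / a) (hu : ∀ i, ‖u i‖ ^ 2 ≤ φ) :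
    ∃ χ : ι → Bool, ∀ k, ∀ y : H, 2 * ∑ i, (if χ i = k then ‖inner 𝕜 y (u i)‖ ^ 2 else 0) ≤
      ‖y‖ ^ 2 + a * ∑ i, ‖inner 𝕜 y (u i)‖ ^ 2 := by
  classical
  obtain ⟨B₀, hB₀⟩ : ∃ B₀ : Matrix ι ι 𝕜, gram 𝕜 u = B₀ᴴ * B₀ := by
    open scoped MatrixOrder in
    exact CStarAlgebra.nonneg_iff_eq_star_mul_self.mp (posSemidef_gram 𝕜 u).nonneg
  obtain ⟨B, hB⟩ : ∃ B : Matrix ι ι ℂ, B = B₀.map (RCLike.toComplexHom 𝕜) := ⟨_, rfl⟩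
  have hG : Bᴴ * B = (gram 𝕜 u).map (RCLike.toComplexHom 𝕜) := by
    rw [hB₀, Matrix.map_mul, hB, conjTranspose_map]
    exact fun x => RCLike.toComplexHom_star x
  obtain ⟨χ, hχ⟩ := exists_posSemidef_selection B ha hφ (fun i => by
    rw [hG, Matrix.map_apply, RCLike.re_toComplexHom, gram_apply, inner_self_eq_norm_sq]
    exact hu i)
  refine ⟨χ, fun k => ?_⟩
  have hspan : ∀ y ∈ Submodule.span 𝕜 (Set.range u),
      2 * ∑ i, (if χ i = k then ‖inner 𝕜 y (u i)‖ ^ 2 else 0) ≤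
        ‖y‖ ^ 2 + a * ∑ i, ‖inner 𝕜 y (u i)‖ ^ 2 := by
    intro y hy
    obtain ⟨c, hc⟩ := (Submodule.mem_span_range_iff_exists_fun 𝕜).1 hy
    have h := (hχ k).quadratic_nonneg (RCLike.toComplexHom 𝕜 ∘ c)
    have hmv : (Bᴴ * B) *ᵥ (RCLike.toComplexHom 𝕜 ∘ c) =
        RCLike.toComplexHom 𝕜 ∘ (gram 𝕜 u *ᵥ c) := by
      funext i
      rw [hG, Function.comp_apply, RingHom.map_mulVec]
    have hGc : ∀ i, (gram 𝕜 u *ᵥ c) i = inner 𝕜 (u i) y := by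
      intro i
      rw [← hc, inner_sum]
      simp only [mulVec, dotProduct, gram_apply, inner_smul_right, mul_comm]
    have hquad : star (RCLike.toComplexHom 𝕜 ∘ c) ⬝ᵥ RCLike.toComplexHom 𝕜 ∘ (gram 𝕜 u *ᵥ c) =
        RCLike.toComplexHom 𝕜 (inner 𝕜 y y) := by
      rw [← hc, ← star_dotProduct_gram_mulVec, RingHom.map_dotProduct]
      congr 1
      funext i
      exact (RCLike.toComplexHom_star _).symm
    rw [hmv, hquad, RCLike.re_toComplexHom, inner_self_eq_norm_sq] at h
    have hsum : ∑ i, (a - (if χ i = k then 2 else 0)) *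
        ‖(RCLike.toComplexHom 𝕜 ∘ (gram 𝕜 u *ᵥ c)) i‖ ^ 2 =
        a * ∑ i, ‖inner 𝕜 y (u i)‖ ^ 2 -
          2 * ∑ i, (if χ i = k then ‖inner 𝕜 y (u i)‖ ^ 2 else 0) := by
      rw [Finset.mul_sum, Finset.mul_sum, ← Finset.sum_sub_distrib]
      refine Finset.sum_congr rfl fun i _ => ?_
      rw [Function.comp_apply, RCLike.norm_toComplexHom_sq, hGc, norm_inner_symm]
      split_ifs <;> ring
    rw [hsum] at h
    linarith
  intro y
  have : FiniteDimensional 𝕜 (Submodule.span 𝕜 (Set.range u)) :=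
    FiniteDimensional.span_of_finite 𝕜 (Set.finite_range u)
  have hproj : ∀ i, inner 𝕜 ((Submodule.span 𝕜 (Set.range u)).starProjection y) (u i) =
      inner 𝕜 y (u i) := by
    intro i
    rw [Submodule.inner_starProjection_left_eq_right,
      Submodule.starProjection_eq_self_iff.2 (Submodule.subset_span (Set.mem_range_self i))]
  -- Projecting to the span keeps every inner product with the family and does not increase the
  -- norm.
  have h := hspan _ (Submodule.starProjection_apply_mem (Submodule.span 𝕜 (Set.range u)) y)
  simp only [hproj] at h
  have hn := Submodule.norm_starProjection_apply_le (Submodule.span 𝕜 (Set.range u)) y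
  have hn2 := pow_le_pow_left₀ (norm_nonneg _) hn 2
  linarith

/-- Weaver's conjecture for a finite Bessel family, with the constant of Marcus, Spielman and
Srivastava. -/
theorem exists_selection_of_bessel {ι : Type*} [Fintype ι] (u : ι → H) {δ : ℝ} (hδ : 0 ≤ δ)
    (hu : ∀ i, ‖u i‖ ^ 2 ≤ δ) (hbessel : ∀ y : H, ∑ i, ‖inner 𝕜 y (u i)‖ ^ 2 ≤ ‖y‖ ^ 2) :
    ∃ χ : ι → Bool, ∀ k, ∀ y : H, ∑ i, (if χ i = k then ‖inner 𝕜 y (u i)‖ ^ 2 else 0) ≤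
      (1 / 2 + (√(2 * δ) + δ)) * ‖y‖ ^ 2 := by
  rcases hδ.eq_or_lt with rfl | hδ
  · refine ⟨fun _ => true, fun k y => ?_⟩
    have h0 : ∀ i, u i = 0 := fun i => by
      have := hu i
      rw [← norm_eq_zero]
      exact pow_eq_zero_iff two_ne_zero |>.1 (le_antisymm this (sq_nonneg _))
    simp only [h0, inner_zero_right, norm_zero]
    simp
  obtain ⟨r, hr⟩ : ∃ r, r = √(2 * δ) := ⟨_, rfl⟩
  have hr0 : 0 < r := by
    rw [hr]
    exact Real.sqrt_pos.2 (by linarith)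
  have hr2 : r ^ 2 = 2 * δ := by
    rw [hr]
    exact Real.sq_sqrt (by linarith)
  -- Scaling by 1/√t with a = 1 + r makes 2δ/t = r/(1 + r) = 1 - 1/a, and the final bound is (t +
  -- a)/2 = (1 + r)²/2 = 1/2 + r + δ.
  obtain ⟨t, ht⟩ : ∃ t, t = r + r ^ 2 := ⟨_, rfl⟩
  have ht0 : 0 < t := by
    rw [ht]
    positivity
  have hst : (√t)⁻¹ ^ 2 = t⁻¹ := by rw [inv_pow, Real.sq_sqrt ht0.le]
  have hnst : ‖(((√t)⁻¹ : ℝ) : 𝕜)‖ ^ 2 = t⁻¹ := by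
    rw [RCLike.norm_ofReal, sq_abs, hst]
  obtain ⟨χ, hχ⟩ := exists_selection_of_norm_sq_le (𝕜 := 𝕜)
    (fun i => (((√t)⁻¹ : ℝ) : 𝕜) • u i) (φ := t⁻¹ * δ) (a := 1 + r) (by linarith)
    (by
      rw [ht, show δ = r ^ 2 / 2 by linarith]
      apply le_of_eq
      field_simp
      ring)
    (fun i => by
      rw [norm_smul, mul_pow, hnst]
      exact mul_le_mul_of_nonneg_left (hu i) (inv_nonneg.2 ht0.le))
  refine ⟨χ, fun k y => ?_⟩
  have h := hχ k y
  have e : ∀ i, ‖inner 𝕜 y ((((√t)⁻¹ : ℝ) : 𝕜) • u i)‖ ^ 2 = t⁻¹ * ‖inner 𝕜 y (u i)‖ ^ 2 := by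
    intro i
    rw [inner_smul_right, norm_mul, mul_pow, hnst]
  simp only [e, ← mul_ite_zero, ← Finset.mul_sum] at h
  have h' := mul_le_mul_of_nonneg_left h ht0.le
  have h1 : t * (2 * (t⁻¹ * ∑ i, (if χ i = k then ‖inner 𝕜 y (u i)‖ ^ 2 else 0))) =
      2 * ∑ i, (if χ i = k then ‖inner 𝕜 y (u i)‖ ^ 2 else 0) := by
    field_simp
  have h2 : t * (‖y‖ ^ 2 + (1 + r) * (t⁻¹ * ∑ i, ‖inner 𝕜 y (u i)‖ ^ 2)) =
      t * ‖y‖ ^ 2 + (1 + r) * ∑ i, ‖inner 𝕜 y (u i)‖ ^ 2 := by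
    field_simp
  rw [h1, h2] at h'
  have h3 := mul_le_mul_of_nonneg_left (hbessel y) (by linarith : (0 : ℝ) ≤ 1 + r)
  have h4 : t * ‖y‖ ^ 2 + (1 + r) * ‖y‖ ^ 2 = 2 * ((1 / 2 + (r + δ)) * ‖y‖ ^ 2) := by
    rw [ht, hr2]
    ring
  rw [← hr]
  linarith

/-- Weaver's conjecture for an arbitrary Bessel family. -/
theorem exists_selection_forall_finset {I : Type*} (u : I → H) {δ : ℝ} (hδ : 0 ≤ δ)
    (hu : ∀ i, ‖u i‖ ^ 2 ≤ δ)
    (hbessel : ∀ (s : Finset I) (y : H), ∑ i ∈ s, ‖inner 𝕜 y (u i)‖ ^ 2 ≤ ‖y‖ ^ 2) :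
    ∃ χ : I → Bool, ∀ (s : Finset I) (k : Bool) (y : H),
      ∑ i ∈ s, (if χ i = k then ‖inner 𝕜 y (u i)‖ ^ 2 else 0) ≤
        (1 / 2 + (√(2 * δ) + δ)) * ‖y‖ ^ 2 := by
  classical
  have hfin : ∀ s : Finset I, ∃ g : I → Bool, ∀ (k : Bool) (y : H),
      ∑ i ∈ s, (if g i = k then ‖inner 𝕜 y (u i)‖ ^ 2 else 0) ≤
        (1 / 2 + (√(2 * δ) + δ)) * ‖y‖ ^ 2 := by
    intro s
    obtain ⟨χ, hχ⟩ := exists_selection_of_bessel (𝕜 := 𝕜) (fun i : s => u i) hδ (fun i => hu i)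
      (fun y => by
        rw [Finset.sum_coe_sort s fun i => ‖inner 𝕜 y (u i)‖ ^ 2]
        exact hbessel s y)
    refine ⟨fun i => if h : i ∈ s then χ ⟨i, h⟩ else true, fun k y => ?_⟩
    rw [← Finset.sum_coe_sort]
    simpa using hχ k y
  choose g hg using hfin
  -- On every finite s, χ agrees with the choice made for some larger t; as the terms are
  -- nonnegative, the bound for t passes to s.
  obtain ⟨χ, hχ⟩ := Finset.rado_selection g
  refine ⟨χ, fun s k y => ?_⟩
  obtain ⟨t, hst, ht⟩ := hχ s
  calc ∑ i ∈ s, (if χ i = k then ‖inner 𝕜 y (u i)‖ ^ 2 else 0)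
      = ∑ i ∈ s, (if g t i = k then ‖inner 𝕜 y (u i)‖ ^ 2 else 0) :=
        Finset.sum_congr rfl fun i hi => by rw [ht i hi]
    _ ≤ ∑ i ∈ t, (if g t i = k then ‖inner 𝕜 y (u i)‖ ^ 2 else 0) :=
        Finset.sum_le_sum_of_subset_of_nonneg hst fun i _ _ => by positivity
    _ ≤ _ := hg t k y

theorem IsParsevalFrame.tsum_eq {I : Type*} {u : I → H} (h : IsParsevalFrame 𝕜 u) (x : H) :
    ∑' i, ‖inner 𝕜 x (u i)‖ ^ 2 = ‖x‖ ^ 2 := by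
  obtain ⟨-, h1, h2⟩ := h.2.2 x
  linarith

theorem FrameInequality.mono {I : Type*} {u : I → H} {A B A' B' : ℝ}
    (h : FrameInequality 𝕜 u A B) (hA : A' ≤ A) (hB : B ≤ B') : FrameInequality 𝕜 u A' B' := by
  intro x
  obtain ⟨h1, h2, h3⟩ := h x
  exact ⟨h1, (mul_le_mul_of_nonneg_right hA (sq_nonneg _)).trans h2,
    h3.trans (mul_le_mul_of_nonneg_right hB (sq_nonneg _))⟩

theorem IsParsevalFrame.frameInequality_restrict {I : Type*} {u : I → H}
    (h : IsParsevalFrame 𝕜 u) (J : Set I) : FrameInequality 𝕜 (fun i : J => u i) 0 1 := by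
  intro x
  have hs := (h.2.2 x).1
  refine ⟨hs.subtype J, ?_, ?_⟩
  · rw [zero_mul]
    exact tsum_nonneg fun _ => sq_nonneg _
  · rw [one_mul, ← h.tsum_eq x]
    exact hs.tsum_subtype_le (fun i => ‖inner 𝕜 x (u i)‖ ^ 2) J (fun _ => sq_nonneg _)

theorem IsParsevalFrame.exists_frameInequality {I : Type*} {u : I → H}
    (h : IsParsevalFrame 𝕜 u) {δ : ℝ} (hδ : 0 ≤ δ) (hu : ∀ i, ‖u i‖ ^ 2 ≤ δ) :
    ∃ χ : I → Bool, ∀ k, FrameInequality 𝕜 (fun i : {i | χ i = k} => u i)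
      (1 / 2 - (√(2 * δ) + δ)) (1 / 2 + (√(2 * δ) + δ)) := by
  classical
  obtain ⟨χ, hχ⟩ := exists_selection_forall_finset (𝕜 := 𝕜) u hδ hu fun s y => by
    rw [← h.tsum_eq y]
    exact (h.2.2 y).1.sum_le_tsum s fun _ _ => sq_nonneg _
  have hle : ∀ k x, ∑' i : {i | χ i = k}, ‖inner 𝕜 x (u i)‖ ^ 2 ≤
      (1 / 2 + (√(2 * δ) + δ)) * ‖x‖ ^ 2 := by
    intro k x
    rw [tsum_subtype {i | χ i = k} fun i => ‖inner 𝕜 x (u i)‖ ^ 2]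
    refine Summable.tsum_le_of_sum_le ((h.2.2 x).1.indicator _) fun s => ?_
    simpa [Set.indicator_apply] using hχ s k x
  refine ⟨χ, fun k x => ⟨(h.2.2 x).1.subtype _, ?_, hle k x⟩⟩
  have hcompl : {i | χ i = k}ᶜ = {i | χ i = !k} := by
    ext i
    simp [Bool.eq_not]
  have hadd := (h.2.2 x).1.tsum_subtype_add_tsum_subtype_compl {i | χ i = k}
  rw [h.tsum_eq, hcompl] at hadd
  have h1 := hle (!k) x
  linarith

end Hilbert

theorem mainTheorem11 :
    ∃ C : ℝ, 0 < C ∧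
      ∀ (𝕜 : Type*) [RCLike 𝕜] (H : Type*) [NormedAddCommGroup H] [InnerProductSpace 𝕜 H]
        [CompleteSpace H] [TopologicalSpace.SeparableSpace H]
        (I : Type*) [Countable I] (u : I → H) (δ : ℝ),
        0 ≤ δ → IsParsevalFrame 𝕜 u → (∀ i, ‖u i‖ ^ 2 ≤ δ) →
        ∃ I₁ I₂ : Set I, I₁ ∪ I₂ = Set.univ ∧ I₁ ∩ I₂ = ∅ ∧
          ∀ J : Set I, J = I₁ ∨ J = I₂ →
            ∀ ε : ℝ, ε = C * √δ ∨ ε = √(2 * δ) + δ →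
              FrameInequality 𝕜 (fun i : J => u i) (1 / 2 - ε) (1 / 2 + ε) ∧
              (ε < 1 / 2 →
                IsFrameWithBounds 𝕜 (fun i : J => u i) (1 / 2 - ε) (1 / 2 + ε)) := by
  -- For δ ≤ 1, √(2δ) + δ ≤ 2√δ + √δ. For δ > 1, ε = 3√δ exceeds 1/2 and the trivial bounds 0 and 1
  -- suffice.
  refine ⟨3, by norm_num, ?_⟩
  intro 𝕜 _ H _ _ _ _ I _ u δ hδ hP hu
  obtain ⟨χ, hχ⟩ := hP.exists_frameInequality hδ hu
  refine ⟨{i | χ i = true}, {i | χ i = false}, ?_, ?_, ?_⟩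
  · ext i
    simp
  · ext i
    simp
  intro J hJ ε hε
  have hε0 : 0 ≤ ε := by
    rcases hε with rfl | rfl <;> positivity
  have hJ' : FrameInequality 𝕜 (fun i : J => u i)
      (1 / 2 - (√(2 * δ) + δ)) (1 / 2 + (√(2 * δ) + δ)) := by
    rcases hJ with rfl | rfl
    exacts [hχ true, hχ false]
  have hfr : FrameInequality 𝕜 (fun i : J => u i) (1 / 2 - ε) (1 / 2 + ε) := by
    rcases hε with rfl | rfl
    · rcases le_or_gt δ 1 with h1 | h1
      · have h2 : √2 ≤ 2 := by
          rw [Real.sqrt_le_left zero_le_two]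
          norm_num
        have h3 : δ ≤ √δ := Real.le_sqrt_of_sq_le (by nlinarith)
        have h4 : √(2 * δ) + δ ≤ 3 * √δ := by
          rw [Real.sqrt_mul zero_le_two]
          nlinarith [Real.sqrt_nonneg δ]
        exact hJ'.mono (by linarith) (by linarith)
      · have h2 : 1 ≤ √δ := Real.one_le_sqrt.2 h1.le
        exact (hP.frameInequality_restrict J).mono (by linarith) (by linarith)
    · exact hJ'
  exact ⟨hfr, fun h => ⟨by linarith, by linarith, hfr⟩⟩
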